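/- Let $n\ge 1$, let $(s_1,\dots,s_n)\in\{\pm1\}^n$ be a fixed sign sequence, and let $T(\delta)=(T_1(\delta),\dots,T_n(\delta))^t$, $\delta>0$, be a one-parameter family of $\mathbb{R}^n$-valued Gaussian random vectors over a probability space $(\Omega,\mathcal F,\mathbb P)$ such that: (i) For each $\delta>0$, $T(\delta)$ has mean $0\in\mathbb{R}^n$ and a positive-definite covariance matrix $C(\delta)\in\mathbb{R}^{n\times n}$; its (positive) eigenvalues, counted with multiplicity and in an arbitrary order, are denoted by $\lambda_1(\delta),\dots,\lambda_n(\delta)$, and $v_1(\delta),\dots,v_n(\delta)$ are corresponding orthonormal eigenvectors. (ii) There is a vector $\bar v_1=(\bar v_{11},\dots,\bar v_{1n})^t\in\mathbb{R}^n$ such that $v_1(\delta)\to\bar v_1$ as $\delta\to0$ and $s_j\,\bar v_{1j}>0$ for all $j=1,\dots,n$. (iii) $\lambda_1(\delta)/\lambda_k(\delta)\to 0$ as $\delta\to0$ for all $k=2,\dots,n$. Then the probability $P(\delta)=\mathbb P\{s_jT_j(\delta)\ge0 \text{ for all } j=1,\dots,n\}$ satisfies $$\lim_{\delta\to0}P(\delta)\cdot\sqrt{\frac{\det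 C(\delta)}{\lambda_1(\delta)^n}}=\frac{\Gamma(n/2)}{2\,\pi^{n/2}\,(n-1)!}\cdot\Bigl|\prod_{j=1}^n\bar v_{1j}\Bigr|^{-1}.$$ -/

import Mathlib

open MeasureTheory ProbabilityTheory Filter Topology

/-- The covariance matrix `(Cov(X_i, X_j))_{i,j}` of a random vector `X` with values in `ℝⁿ`. -/
noncomputable def covarianceMatrix {Ω : Type*} [MeasurableSpace Ω] {n : ℕ}
    (X : Ω → EuclideanSpace ℝ (Fin n)) (P : Measure Ω) : Matrix (Fin n) (Fin n) ℝ :=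
  Matrix.of fun i j => covariance (fun ω => X ω i) (fun ω => X ω j) P

/-- The probability that `s_j X_j ≥ 0` for all `j`. -/
noncomputable def orthantProb {Ω : Type*} [MeasurableSpace Ω] {n : ℕ}
    (s : Fin n → ℝ) (X : Ω → EuclideanSpace ℝ (Fin n)) (P : Measure Ω) : ℝ :=
  P.real {ω | ∀ j, 0 ≤ s j * X ω j}

/-! In an eigenbasis the Gaussian density is explicit. The orthant is a cone, so substituting x =
√λ₁ y keeps the domain and turns the normalised probability into (2π)^(-n/2) ∫ exp(-½ ∑ (λ₁/λᵢ)⟨vᵢ,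
y⟩²) dy over the orthant (`orthantProb_mul_sqrt_det_div`). Every term but the first vanishes in the
limit, leaving exp(-½⟨v̄₁, y⟩²). Dominated convergence applies because v̄₁ lies in the open orthant:
⟨v₁, y⟩ ≥ ½⟨v̄₁, y⟩ ≥ 0 there for small δ (`tendsto_integral_signOrthant`). In the limit integral,
uⱼ = v̄₁ⱼ yⱼ yields the factor |∏ v̄₁ⱼ|⁻¹ and a function of ∑ uⱼ on the nonnegative orthant; slicing
by the sum leaves a one-dimensional Gamma integral with weight r^(n-1)/(n-1)!. -/

/-! ### Integrals of functions of the coordinate sum -/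

theorem lintegral_Ico_ofReal_sub_pow_div_factorial (n : ℕ) {x : ℝ} (hx : 0 ≤ x) :
    ∫⁻ t in Set.Ico 0 x, ENNReal.ofReal ((x - t) ^ n / n.factorial) =
      ENNReal.ofReal (x ^ (n + 1) / (n + 1).factorial) := by
  rw [restrict_Ico_eq_restrict_Ioc, ← ofReal_integral_eq_lintegral_ofReal,
    ← intervalIntegral.integral_of_le hx]
  · congr 1
    rw [intervalIntegral.integral_div,
      intervalIntegral.integral_comp_sub_left (fun t => t ^ n) x, integral_pow, Nat.factorial_succ]
    push_cast
    field_simp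
    simp
  · exact ((by fun_prop : Continuous fun t : ℝ => (x - t) ^ n / n.factorial).integrableOn_Icc
      (a := 0) (b := x)).mono_set Set.Ioc_subset_Icc_self
  · filter_upwards [ae_restrict_mem measurableSet_Ioc] with t ht
    have : 0 ≤ x - t := sub_nonneg.2 ht.2
    positivity

/-- The induction step for slicing the orthant: put x = t + r and swap by Tonelli; the integral over
0 ≤ t < x raises the power by one. -/
theorem lintegral_lintegral_add_mul_pow_div_factorial (n : ℕ) {f : ℝ → ENNReal}
    (hf : Measurable f) :
    ∫⁻ t in Set.Ici (0 : ℝ), ∫⁻ r in Set.Ioi (0 : ℝ),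
        ENNReal.ofReal (r ^ n / n.factorial) * f (t + r) =
      ∫⁻ r in Set.Ioi (0 : ℝ), ENNReal.ofReal (r ^ (n + 1) / (n + 1).factorial) * f r := by
  have hshift (t : ℝ) : ∫⁻ r in Set.Ioi (0 : ℝ), ENNReal.ofReal (r ^ n / n.factorial) * f (t + r) =
      ∫⁻ x, (Set.Ioi t).indicator (fun x => ENNReal.ofReal ((x - t) ^ n / n.factorial) * f x) x := by
    rw [← lintegral_indicator measurableSet_Ioi,
      ← lintegral_sub_right_eq_self _ t]
    refine lintegral_congr fun x => ?_
    simp [Set.indicator_apply]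
  have hmeas : Measurable (Function.uncurry fun (t x : ℝ) =>
      {p : ℝ × ℝ | 0 ≤ p.1 ∧ p.1 < p.2}.indicator
        (fun p => ENNReal.ofReal ((p.2 - p.1) ^ n / n.factorial) * f p.2) (t, x)) := by
    refine Measurable.indicator (by fun_prop) ?_
    exact (measurableSet_le measurable_const measurable_fst).inter
      (measurableSet_lt measurable_fst measurable_snd)
  calc
    _ = ∫⁻ t, ∫⁻ x, {p : ℝ × ℝ | 0 ≤ p.1 ∧ p.1 < p.2}.indicator
        (fun p => ENNReal.ofReal ((p.2 - p.1) ^ n / n.factorial) * f p.2) (t, x) := by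
      rw [← lintegral_indicator measurableSet_Ici]
      refine lintegral_congr fun t => ?_
      simp_rw [hshift]
      by_cases ht : 0 ≤ t <;> simp [Set.indicator_apply, ht]
    _ = _ := by
      rw [lintegral_lintegral_swap hmeas.aemeasurable, ← lintegral_indicator measurableSet_Ioi]
      refine lintegral_congr fun x => ?_
      by_cases hx : 0 < x
      · rw [Set.indicator_of_mem (Set.mem_Ioi.2 hx),
          ← lintegral_Ico_ofReal_sub_pow_div_factorial n hx.le,
          ← lintegral_mul_const _ (by fun_prop), ← lintegral_indicator measurableSet_Ico]
        refine lintegral_congr fun t => ?_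
        simp [Set.indicator_apply]
      · rw [Set.indicator_of_notMem (by simpa using hx)]
        refine (lintegral_congr fun t => ?_).trans lintegral_zero
        refine Set.indicator_of_notMem ?_ _
        rintro ⟨h1, h2⟩
        exact hx (lt_of_le_of_lt h1 h2)

/-- Integrating a function of the coordinate sum over the nonnegative orthant. -/
theorem lintegral_nonneg_orthant_comp_sum (n : ℕ) {f : ℝ → ENNReal} (hf : Measurable f) :
    ∫⁻ u in {u : Fin (n + 1) → ℝ | ∀ j, 0 ≤ u j}, f (∑ j, u j) =
      ∫⁻ r in Set.Ioi (0 : ℝ), ENNReal.ofReal (r ^ n / n.factorial) * f r := by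
  induction n generalizing f with
  | zero =>
    have hpres : MeasurePreserving (MeasurableEquiv.funUnique (Fin 1) ℝ).symm volume volume :=
      (measurePreserving_funUnique volume (Fin 1)).symm
    rw [← hpres.setLIntegral_comp_preimage_emb
      (MeasurableEquiv.measurableEmbedding _), setLIntegral_congr Ioi_ae_eq_Ici]
    simp [MeasurableEquiv.funUnique, Set.Ici, Set.preimage]
  | succ n ih =>
    -- Coordinate 0 is split off as t; the induction hypothesis is then used for the shifted
    -- function f (t + ·).
    rw [← lintegral_lintegral_add_mul_pow_div_factorial n hf,
      ← (volume_preserving_piFinSuccAbove (fun _ : Fin (n + 2) => ℝ)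
          0).symm.setLIntegral_comp_preimage_emb (MeasurableEquiv.measurableEmbedding _)]
    have hset : (MeasurableEquiv.piFinSuccAbove (fun _ : Fin (n + 2) => ℝ) 0).symm ⁻¹'
        {u | ∀ j, 0 ≤ u j} = Set.Ici 0 ×ˢ {u : Fin (n + 1) → ℝ | ∀ j, 0 ≤ u j} := by
      ext p
      simp [MeasurableEquiv.piFinSuccAbove_symm_apply, Fin.insertNthEquiv, Fin.forall_fin_succ]
    rw [hset, Measure.volume_eq_prod, ← Measure.prod_restrict,
      lintegral_prod _ (by fun_prop)]
    refine lintegral_congr fun t => ?_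
    rw [← ih (f := fun r => f (t + r)) (by fun_prop)]
    refine lintegral_congr fun u => ?_
    simp [MeasurableEquiv.piFinSuccAbove_symm_apply, Fin.insertNthEquiv, Fin.sum_univ_succ]

theorem lintegral_pow_div_factorial_mul_exp_neg_mul_sq (n : ℕ) {c : ℝ} (hc : 0 < c) :
    ∫⁻ r in Set.Ioi (0 : ℝ),
        ENNReal.ofReal (r ^ n / n.factorial) * ENNReal.ofReal (Real.exp (-c * r ^ 2)) =
      ENNReal.ofReal (c ^ (-((n : ℝ) + 1) / 2) / 2 * Real.Gamma (((n : ℝ) + 1) / 2) /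
        n.factorial) := by
  have h := integral_rpow_mul_exp_neg_mul_rpow (p := 2) (q := n) two_pos
    (by linarith [(n.cast_nonneg : (0 : ℝ) ≤ n)]) hc
  have hi := integrableOn_rpow_mul_exp_neg_mul_sq hc (s := n)
    (by linarith [(n.cast_nonneg : (0 : ℝ) ≤ n)])
  simp only [Real.rpow_natCast, Real.rpow_ofNat] at h hi
  rw [mul_one_div] at h
  rw [← h, ← integral_div, ofReal_integral_eq_lintegral_ofReal (hi.div_const _)]
  · refine setLIntegral_congr_fun measurableSet_Ioi fun r hr => ?_
    have : (0 : ℝ) < r := hr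
    rw [← ENNReal.ofReal_mul (by positivity)]
    congr 1
    ring
  · filter_upwards [ae_restrict_mem measurableSet_Ioi] with r hr
    have : (0 : ℝ) < r := hr
    positivity

theorem pi_gaussianReal_eq_withDensity {ι : Type*} [Fintype ι] (m : ι → ℝ) {w : ι → NNReal}
    (hw : ∀ i, w i ≠ 0) :
    Measure.pi (fun i => gaussianReal (m i) (w i)) =
      volume.withDensity fun x => ENNReal.ofReal (∏ i, gaussianPDFReal (m i) (w i) (x i)) := by
  refine Measure.pi_eq fun s hs => ?_
  rw [withDensity_apply _ (MeasurableSet.univ_pi hs), volume_pi, Measure.restrict_pi_pi,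
    ← ofReal_integral_eq_lintegral_ofReal, integral_fintype_prod_eq_prod,
    ENNReal.ofReal_prod_of_nonneg]
  · simp_rw [gaussianReal_apply_eq_integral _ (hw _)]
  · exact fun i _ => integral_nonneg fun x => gaussianPDFReal_nonneg _ _ _
  · exact Integrable.fintype_prod fun i => (integrable_gaussianPDFReal _ _).restrict
  · exact ae_of_all _ fun x => Finset.prod_nonneg fun i _ => gaussianPDFReal_nonneg _ _ _

/-! ### Gaussian law in an eigenbasis of the covariance -/

section Eigenbasis

variable {Ω : Type*} [MeasurableSpace Ω] {P : Measure Ω} {n : ℕ}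
  {X : Ω → EuclideanSpace ℝ (Fin n)}

theorem covariance_inner_inner (hX : HasGaussianLaw X P) (x y : EuclideanSpace ℝ (Fin n)) :
    covariance (fun ω => inner ℝ x (X ω)) (fun ω => inner ℝ y (X ω)) P =
      dotProduct x.ofLp ((covarianceMatrix X P).mulVec y.ofLp) := by
  have := hX.isProbabilityMeasure
  have hmem (x : EuclideanSpace ℝ (Fin n)) (i : Fin n) : MemLp (fun ω => X ω i * x i) 2 P :=
    (hX.map_fun (EuclideanSpace.proj i)).memLp_two.mul_const _
  simp only [PiLp.inner_apply, RCLike.inner_apply, conj_trivial]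
  rw [covariance_fun_sum_fun_sum (hmem x) (hmem y)]
  simp only [covariance_mul_const_left, covariance_mul_const_right, dotProduct, Matrix.mulVec,
    Finset.mul_sum, covarianceMatrix, Matrix.of_apply]
  exact Finset.sum_congr rfl fun i _ => Finset.sum_congr rfl fun j _ => by ring

variable {b : OrthonormalBasis (Fin n) ℝ (EuclideanSpace ℝ (Fin n))} {l : Fin n → ℝ}

theorem covariance_inner_eigenbasis (hX : HasGaussianLaw X P)
    (heig : ∀ k, (covarianceMatrix X P).mulVec (b k).ofLp = l k • (b k).ofLp) (i j : Fin n) :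
    covariance (fun ω => inner ℝ (b i) (X ω)) (fun ω => inner ℝ (b j) (X ω)) P =
      if i = j then l j else 0 := by
  rw [covariance_inner_inner hX, heig, dotProduct_smul]
  have h : dotProduct (b i).ofLp (b j).ofLp = inner ℝ (b i) (b j) := by
    simp [PiLp.inner_apply, dotProduct, mul_comm]
  rw [h, orthonormal_iff_ite.1 b.orthonormal]
  simp

/-- The eigenbasis coordinates are jointly Gaussian and uncorrelated, hence independent. -/
theorem map_inner_eigenbasis (hX : HasGaussianLaw X P) (hmean : ∫ ω, X ω ∂P = 0)
    (heig : ∀ k, (covarianceMatrix X P).mulVec (b k).ofLp = l k • (b k).ofLp) :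
    P.map (fun ω i => inner ℝ (b i) (X ω)) =
      Measure.pi fun i => gaussianReal 0 (l i).toNNReal := by
  have := hX.isProbabilityMeasure
  have hW : HasGaussianLaw (fun ω => fun i => inner ℝ (b i) (X ω)) P :=
    hX.map_fun (ContinuousLinearMap.pi fun i => innerSL ℝ (b i))
  have hWi (i : Fin n) : HasGaussianLaw (fun ω => inner ℝ (b i) (X ω)) P :=
    hX.map_fun (innerSL ℝ (b i))
  have hind : iIndepFun (fun i ω => inner ℝ (b i) (X ω)) P :=
    HasGaussianLaw.iIndepFun_of_covariance_eq_zero hW fun i j hij => by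
      rw [covariance_inner_eigenbasis hX heig, if_neg hij]
  rw [hind.map_fun_eq_pi_map fun i => (hWi i).aemeasurable]
  congr 1
  funext i
  rw [(hWi i).map_eq_gaussianReal, ← covariance_self (hWi i).aemeasurable,
    covariance_inner_eigenbasis hX heig, integral_inner hX.integrable, hmean]
  simp

theorem det_covarianceMatrix_eq_prod
    (heig : ∀ k, (covarianceMatrix X P).mulVec (b k).ofLp = l k • (b k).ofLp) :
    (covarianceMatrix X P).det = ∏ i, l i := by
  set V : Matrix (Fin n) (Fin n) ℝ := Matrix.of fun i k => b k i with hV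
  have hVV : V.transpose * V = 1 := by
    ext i j
    have := orthonormal_iff_ite.1 b.orthonormal i j
    simp only [PiLp.inner_apply, RCLike.inner_apply, conj_trivial] at this
    simp [Matrix.mul_apply, hV, Matrix.one_apply, ← this, mul_comm]
  have hdet : V.det ≠ 0 := fun h => by
    have := congrArg Matrix.det hVV
    simp [h] at this
  have hmul : covarianceMatrix X P * V = V * Matrix.diagonal l := by
    ext i k
    have := congrFun (heig k) i
    rw [Matrix.mul_diagonal]
    simpa [Matrix.mul_apply, Matrix.mulVec, dotProduct, hV, mul_comm] using this
  have := congrArg Matrix.det hmul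
  rw [Matrix.det_mul, Matrix.det_mul, Matrix.det_diagonal, mul_comm] at this
  exact mul_left_cancel₀ hdet this

theorem eigenvalue_pos (hpos : (covarianceMatrix X P).PosDef)
    (heig : ∀ k, (covarianceMatrix X P).mulVec (b k).ofLp = l k • (b k).ofLp) (k : Fin n) :
    0 < l k := by
  have hne : (b k).ofLp ≠ 0 := fun h => b.orthonormal.ne_zero k (by ext i; simp [h])
  have h := hpos.dotProduct_mulVec_pos hne
  rw [heig, dotProduct_smul] at h
  have h1 : 0 ≤ dotProduct (star (b k).ofLp) (b k).ofLp := dotProduct_star_self_nonneg _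
  exact pos_of_mul_pos_left h h1

/-- The probability of an event in terms of the Gaussian density in an eigenbasis. -/
theorem measureReal_preimage_eq_setIntegral (hX : HasGaussianLaw X P) (hmean : ∫ ω, X ω ∂P = 0)
    (heig : ∀ k, (covarianceMatrix X P).mulVec (b k).ofLp = l k • (b k).ofLp)
    (hl : ∀ k, 0 < l k) {A : Set (EuclideanSpace ℝ (Fin n))} (hA : MeasurableSet A) :
    P.real (X ⁻¹' A) =
      ∫ x in A, ∏ i, gaussianPDFReal 0 (l i).toNNReal (inner ℝ (b i) x) := by
  set e : EuclideanSpace ℝ (Fin n) ≃ᵐ (Fin n → ℝ) :=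
    b.measurableEquiv.trans (MeasurableEquiv.toLp 2 (Fin n → ℝ)).symm with he_def
  have he : MeasurePreserving e :=
    (EuclideanSpace.volume_preserving_symm_measurableEquiv_toLp (Fin n)).comp
      b.measurePreserving_measurableEquiv
  have hval (x : EuclideanSpace ℝ (Fin n)) : e x = fun i => inner ℝ (b i) x := by
    ext i
    exact b.repr_apply_apply x i
  have hmeas : MeasurableSet (e.symm ⁻¹' A) := e.symm.measurable hA
  have hpre : X ⁻¹' A = (fun ω i => inner ℝ (b i) (X ω)) ⁻¹' (e.symm ⁻¹' A) := by
    ext ω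
    simp [← hval]
  have haem : AEMeasurable (fun ω i => inner ℝ (b i) (X ω)) P :=
    (hX.map_fun (ContinuousLinearMap.pi fun i => innerSL ℝ (b i))).aemeasurable
  have hnn : ∀ y : Fin n → ℝ, 0 ≤ ∏ i, gaussianPDFReal 0 (l i).toNNReal (y i) :=
    fun y => Finset.prod_nonneg fun i _ => gaussianPDFReal_nonneg _ _ _
  have hm : Measurable fun y : Fin n → ℝ => ∏ i, gaussianPDFReal 0 (l i).toNNReal (y i) := by
    fun_prop
  rw [Measure.real, hpre, ← Measure.map_apply_of_aemeasurable haem hmeas,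
    map_inner_eigenbasis hX hmean heig,
    pi_gaussianReal_eq_withDensity _ fun i => by simpa using hl i, withDensity_apply _ hmeas,
    ← integral_eq_lintegral_of_nonneg_ae (ae_of_all _ hnn) hm.aestronglyMeasurable,
    ← he.setIntegral_preimage_emb e.measurableEmbedding]
  simp [hval, ← Set.preimage_comp]

end Eigenbasis

/-- The closed orthant of vectors whose coordinates have the signs prescribed by `s`. -/
def signOrthant {n : ℕ} (s : Fin n → ℝ) : Set (EuclideanSpace ℝ (Fin n)) :=
  {x | ∀ j, 0 ≤ s j * x j}

/-! ### Gaussian integral over a sign orthant -/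

section SignOrthant

variable {n : ℕ} {s : Fin n → ℝ}

theorem measurableSet_signOrthant : MeasurableSet (signOrthant s) := by
  simp only [signOrthant, Set.ofPred_forall]
  exact MeasurableSet.iInter fun j => measurableSet_le measurable_const (by fun_prop)

open scoped Pointwise in
theorem smul_signOrthant {r : ℝ} (hr : 0 < r) : r • signOrthant s = signOrthant s := by
  ext x
  rw [Set.mem_smul_set_iff_inv_smul_mem₀ hr.ne']
  refine forall_congr' fun j => ?_
  rw [PiLp.smul_apply, smul_eq_mul, mul_left_comm, mul_nonneg_iff_of_pos_left (inv_pos.2 hr)]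

theorem lintegral_comp_mul_coord (a : Fin n → ℝ) (ha : ∀ j, a j ≠ 0) {g : (Fin n → ℝ) → ENNReal}
    (hg : Measurable g) :
    ∫⁻ y : Fin n → ℝ, g (fun j => a j * y j) = ENNReal.ofReal |∏ j, a j|⁻¹ * ∫⁻ u, g u := by
  have hprod : ∏ j, a j ≠ 0 := Finset.prod_ne_zero_iff.2 fun j _ => ha j
  have hdet : Matrix.det (Matrix.diagonal a) ≠ 0 := by rwa [Matrix.det_diagonal]
  have hcoe : ⇑(Matrix.toLin' (Matrix.diagonal a)) = fun y j => a j * y j := by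
    ext y j
    simp [Matrix.mulVec_diagonal]
  have hmap := Real.smul_map_diagonal_volume_pi hdet
  rw [Matrix.det_diagonal, hcoe] at hmap
  nth_rewrite 2 [← hmap]
  rw [lintegral_smul_measure, lintegral_map hg (by fun_prop), smul_eq_mul, ← mul_assoc,
    ← ENNReal.ofReal_mul (by positivity), inv_mul_cancel₀ (abs_ne_zero.2 hprod)]
  simp

variable [NeZero n] {a : EuclideanSpace ℝ (Fin n)}

/-- Since aⱼ has the sign of sⱼ, the substitution uⱼ = aⱼ yⱼ carries the sign orthant to the
nonnegative one and ⟨a, y⟩ to ∑ uⱼ. -/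
theorem lintegral_signOrthant_exp_neg_mul_inner_sq (hs : ∀ j, 0 < s j * a j) {c : ℝ}
    (hc : 0 < c) :
    ∫⁻ y in signOrthant s, ENNReal.ofReal (Real.exp (-c * inner ℝ a y ^ 2)) =
      ENNReal.ofReal (|∏ j, a j|⁻¹ *
        (c ^ (-(n : ℝ) / 2) / 2 * Real.Gamma ((n : ℝ) / 2) / (n - 1).factorial)) := by
  obtain ⟨m, rfl⟩ := Nat.exists_eq_succ_of_ne_zero (NeZero.ne n)
  have ha (j) : a j ≠ 0 := fun h => by simpa [h] using hs j
  have horth : signOrthant s = {y | ∀ j, 0 ≤ a j * y j} := by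
    ext y
    refine forall_congr' fun j => ?_
    -- Both conditions reduce to the sign of (sⱼ aⱼ)(sⱼ yⱼ) = sⱼ² (aⱼ yⱼ).
    have h2 : 0 < s j ^ 2 := by have := left_ne_zero_of_mul (hs j).ne'; positivity
    rw [← mul_nonneg_iff_of_pos_left (hs j), ← mul_nonneg_iff_of_pos_left h2 (b := a j * y j)]
    ring_nf
  let g : (Fin (m + 1) → ℝ) → ENNReal := {u : Fin (m + 1) → ℝ | ∀ j, 0 ≤ u j}.indicator fun u =>
    ENNReal.ofReal (Real.exp (-c * (∑ j, u j) ^ 2))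
  have hms : MeasurableSet {u : Fin (m + 1) → ℝ | ∀ j, 0 ≤ u j} :=
    measurableSet_Ici (a := (0 : Fin (m + 1) → ℝ))
  have hg : Measurable g := Measurable.indicator (by fun_prop) hms
  have hm := lintegral_comp_mul_coord (fun j => a j) ha hg
  rw [lintegral_indicator hms,
    lintegral_nonneg_orthant_comp_sum m (f := fun r => ENNReal.ofReal (Real.exp (-c * r ^ 2)))
      (by fun_prop), lintegral_pow_div_factorial_mul_exp_neg_mul_sq m hc,
    ← ENNReal.ofReal_mul (by positivity)] at hm
  rw [← lintegral_indicator measurableSet_signOrthant,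
    ← (PiLp.volume_preserving_toLp (Fin (m + 1))).lintegral_comp_emb
      (MeasurableEquiv.toLp 2 (Fin (m + 1) → ℝ)).measurableEmbedding]
  convert hm using 1
  · refine lintegral_congr fun y => ?_
    simp [g, Set.indicator_apply, horth, PiLp.inner_apply, mul_comm]
  · simp

theorem integrableOn_signOrthant_exp_neg_mul_inner_sq (hs : ∀ j, 0 < s j * a j) {c : ℝ}
    (hc : 0 < c) :
    IntegrableOn (fun y => Real.exp (-c * inner ℝ a y ^ 2)) (signOrthant s) := by
  refine ⟨by fun_prop, ?_⟩
  rw [hasFiniteIntegral_iff_ofReal (ae_of_all _ fun y => (Real.exp_pos _).le),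
    lintegral_signOrthant_exp_neg_mul_inner_sq hs hc]
  exact ENNReal.ofReal_lt_top

theorem integral_signOrthant_exp_neg_mul_inner_sq (hs : ∀ j, 0 < s j * a j) {c : ℝ}
    (hc : 0 < c) :
    ∫ y in signOrthant s, Real.exp (-c * inner ℝ a y ^ 2) =
      |∏ j, a j|⁻¹ *
        (c ^ (-(n : ℝ) / 2) / 2 * Real.Gamma ((n : ℝ) / 2) / (n - 1).factorial) := by
  have hn : (0 : ℝ) < n := Nat.cast_pos.2 (NeZero.pos n)
  have := Real.Gamma_pos_of_pos (half_pos hn)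
  rw [integral_eq_lintegral_of_nonneg_ae (ae_of_all _ fun y => (Real.exp_pos _).le)
    (by fun_prop), lintegral_signOrthant_exp_neg_mul_inner_sq hs hc,
    ENNReal.toReal_ofReal (by positivity)]

end SignOrthant

/-! ### Rescaling by the square root of an eigenvalue -/

section Rescaling

variable {Ω : Type*} [MeasurableSpace Ω] {P : Measure Ω} {n : ℕ}
  {X : Ω → EuclideanSpace ℝ (Fin n)}
  {b : OrthonormalBasis (Fin n) ℝ (EuclideanSpace ℝ (Fin n))} {l : Fin n → ℝ}

theorem prod_gaussianPDFReal_inner_smul (hl : ∀ k, 0 < l k) {r : ℝ} (hr : 0 < r)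
    (y : EuclideanSpace ℝ (Fin n)) :
    ∏ i, gaussianPDFReal 0 (l i).toNNReal (inner ℝ (b i) (√r • y)) =
      (√(2 * Real.pi) ^ n * √(∏ i, l i))⁻¹ *
        Real.exp (-(1 / 2) * ∑ i, r / l i * inner ℝ (b i) y ^ 2) := by
  have hpi := Real.pi_pos
  simp only [gaussianPDFReal, Finset.prod_mul_distrib, Finset.prod_inv_distrib]
  congr 1
  · rw [Real.sqrt_prod _ fun i _ => (hl i).le]
    have h (i : Fin n) : √(2 * Real.pi * ((l i).toNNReal : ℝ)) = √(2 * Real.pi) * √(l i) := by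
      rw [Real.coe_toNNReal _ (hl i).le, Real.sqrt_mul (by positivity)]
    simp only [h, Finset.prod_mul_distrib, Finset.prod_const, Finset.card_univ, Fintype.card_fin]
  · rw [← Real.exp_sum, Finset.mul_sum]
    congr 1
    refine Finset.sum_congr rfl fun i _ => ?_
    have := (hl i).ne'
    rw [Real.coe_toNNReal _ (hl i).le, inner_smul_right, sub_zero, mul_pow, Real.sq_sqrt hr.le]
    field_simp

/-- The Jacobian √r ^ n and the factor √det of the density are exactly what the normalisation
cancels. -/
theorem orthantProb_mul_sqrt_det_div (hX : HasGaussianLaw X P) (hmean : ∫ ω, X ω ∂P = 0)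
    (heig : ∀ k, (covarianceMatrix X P).mulVec (b k).ofLp = l k • (b k).ofLp)
    (hl : ∀ k, 0 < l k) {r : ℝ} (hr : 0 < r) (s : Fin n → ℝ) :
    orthantProb s X P * √((covarianceMatrix X P).det / r ^ n) =
      (√(2 * Real.pi) ^ n)⁻¹ * ∫ y in signOrthant s,
        Real.exp (-(1 / 2) * ∑ i, r / l i * inner ℝ (b i) y ^ 2) := by
  have hpi := Real.pi_pos
  have hdet : 0 < ∏ i, l i := Finset.prod_pos fun i _ => hl i
  have hprob : orthantProb s X P =
      ∫ x in signOrthant s, ∏ i, gaussianPDFReal 0 (l i).toNNReal (inner ℝ (b i) x) :=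
    measureReal_preimage_eq_setIntegral hX hmean heig hl measurableSet_signOrthant
  have hscale := Measure.setIntegral_comp_smul_of_pos volume
    (fun x : EuclideanSpace ℝ (Fin n) =>
      ∏ i, gaussianPDFReal 0 (l i).toNNReal (inner ℝ (b i) x)) (signOrthant s) (Real.sqrt_pos.2 hr)
  rw [smul_signOrthant (Real.sqrt_pos.2 hr), ← hprob] at hscale
  simp only [prod_gaussianPDFReal_inner_smul hl hr, integral_const_mul, finrank_euclideanSpace,
    Fintype.card_fin, smul_eq_mul] at hscale
  have hsr : 0 < √r := Real.sqrt_pos.2 hr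
  have hpow : √(r ^ n) = √r ^ n := (Real.sqrt_eq_iff_mul_self_eq (by positivity)
    (by positivity)).2 (by rw [← mul_pow, Real.mul_self_sqrt hr.le])
  rw [det_covarianceMatrix_eq_prod heig, Real.sqrt_div hdet.le, hpow]
  have hsd : 0 < √(∏ i, l i) := Real.sqrt_pos.2 hdet
  rw [eq_comm, inv_mul_eq_iff_eq_mul₀ (by positivity)] at hscale
  rw [hscale]
  field_simp

end Rescaling

/-! ### Dominated convergence -/

section Limit

variable {n : ℕ} [NeZero n] {s : Fin n → ℝ} {lam : ℝ → Fin n → ℝ}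
  {v : ℝ → Fin n → EuclideanSpace ℝ (Fin n)} {vbar : EuclideanSpace ℝ (Fin n)} {F : Filter ℝ}

/-- The other eigenvectors need not converge: ⟨vᵢ, y⟩² ≤ ‖y‖² by Cauchy–Schwarz, so their vanishing
coefficients suffice. -/
theorem tendsto_sum_ratio_mul_inner_sq (hpos : ∀ᶠ δ in F, 0 < lam δ 0)
    (hnorm : ∀ᶠ δ in F, ∀ k, ‖v δ k‖ = 1)
    (hv : Tendsto (fun δ => v δ 0) F (𝓝 vbar))
    (hlam : ∀ k, k ≠ 0 → Tendsto (fun δ => lam δ 0 / lam δ k) F (𝓝 0))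
    (y : EuclideanSpace ℝ (Fin n)) :
    Tendsto (fun δ => ∑ i, lam δ 0 / lam δ i * inner ℝ (v δ i) y ^ 2) F
      (𝓝 (inner ℝ vbar y ^ 2)) := by
  have hterm (i : Fin n) : Tendsto (fun δ => lam δ 0 / lam δ i * inner ℝ (v δ i) y ^ 2) F
      (𝓝 (if i = 0 then inner ℝ vbar y ^ 2 else 0)) := by
    split_ifs with hi
    · subst hi
      refine ((hv.inner tendsto_const_nhds).pow 2).congr' ?_
      filter_upwards [hpos] with δ hδ
      rw [div_self hδ.ne', one_mul]
    · have h0 := ((hlam i hi).norm.mul_const (‖y‖ ^ 2))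
      rw [norm_zero, zero_mul] at h0
      refine squeeze_zero_norm' ?_ h0
      filter_upwards [hnorm] with δ hδ
      rw [norm_mul, norm_pow]
      gcongr
      simpa [hδ] using norm_inner_le_norm (𝕜 := ℝ) (v δ i) y
  simpa using tendsto_finsetSum Finset.univ fun i _ => hterm i

/-- Uniformity in y comes from comparing coordinates: as sⱼ² = 1, the inner product is ∑ (sⱼ xⱼ)(sⱼ
yⱼ) with sⱼ yⱼ ≥ 0. -/
theorem eventually_half_inner_le_inner (hs : ∀ j, s j = 1 ∨ s j = -1)
    (hv : Tendsto (fun δ => v δ 0) F (𝓝 vbar)) (hsign : ∀ j, 0 < s j * vbar j) :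
    ∀ᶠ δ in F, ∀ y ∈ signOrthant s,
      0 ≤ inner ℝ vbar y ∧ inner ℝ vbar y / 2 ≤ inner ℝ (v δ 0) y := by
  have hev : ∀ᶠ δ in F, ∀ j, s j * vbar j / 2 < s j * v δ 0 j := by
    refine eventually_all.2 fun j => ?_
    have h : Tendsto (fun δ => s j * v δ 0 j) F (𝓝 (s j * vbar j)) :=
      ((((EuclideanSpace.proj j : _ →L[ℝ] ℝ).continuous.tendsto vbar).comp hv)).const_mul (s j)
    exact h.eventually_const_lt (half_lt_self (hsign j))
  have hinner (x y : EuclideanSpace ℝ (Fin n)) :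
      inner ℝ x y = ∑ j, s j * x j * (s j * y j) := by
    simp only [PiLp.inner_apply, RCLike.inner_apply, conj_trivial]
    refine Finset.sum_congr rfl fun j _ => ?_
    rcases hs j with h | h <;> rw [h] <;> ring
  filter_upwards [hev] with δ hδ y hy
  rw [hinner, hinner, Finset.sum_div]
  refine ⟨Finset.sum_nonneg fun j _ => mul_nonneg (hsign j).le (hy j),
    Finset.sum_le_sum fun j _ => ?_⟩
  rw [mul_div_right_comm]
  exact mul_le_mul_of_nonneg_right (hδ j).le (hy j)

theorem tendsto_integral_signOrthant [F.IsCountablyGenerated] (hs : ∀ j, s j = 1 ∨ s j = -1)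
    (hpos : ∀ᶠ δ in F, ∀ k, 0 < lam δ k) (hnorm : ∀ᶠ δ in F, ∀ k, ‖v δ k‖ = 1)
    (hv : Tendsto (fun δ => v δ 0) F (𝓝 vbar)) (hsign : ∀ j, 0 < s j * vbar j)
    (hlam : ∀ k, k ≠ 0 → Tendsto (fun δ => lam δ 0 / lam δ k) F (𝓝 0)) :
    Tendsto (fun δ => ∫ y in signOrthant s,
        Real.exp (-(1 / 2) * ∑ i, lam δ 0 / lam δ i * inner ℝ (v δ i) y ^ 2)) F
      (𝓝 (∫ y in signOrthant s, Real.exp (-(1 / 2) * inner ℝ vbar y ^ 2))) := by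
  -- The constant 1/8 is ½ · (½)², from squaring the bound ⟨v₁, y⟩ ≥ ½⟨v̄₁, y⟩.
  refine tendsto_integral_filter_of_dominated_convergence
    (fun y => Real.exp (-(1 / 8) * inner ℝ vbar y ^ 2)) ?_ ?_
    (integrableOn_signOrthant_exp_neg_mul_inner_sq hsign (by norm_num)) ?_
  · exact Eventually.of_forall fun δ => by fun_prop
  · filter_upwards [hpos, eventually_half_inner_le_inner hs hv hsign] with δ hδ hle
    filter_upwards [ae_restrict_mem measurableSet_signOrthant] with y hy
    obtain ⟨h0, h1⟩ := hle y hy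
    -- All terms are nonnegative and the one at index 0 has coefficient 1.
    have hterm : inner ℝ (v δ 0) y ^ 2 ≤ ∑ i, lam δ 0 / lam δ i * inner ℝ (v δ i) y ^ 2 := by
      have := Finset.single_le_sum (f := fun i => lam δ 0 / lam δ i * inner ℝ (v δ i) y ^ 2)
        (fun i _ => mul_nonneg (div_pos (hδ 0) (hδ i)).le (sq_nonneg _)) (Finset.mem_univ 0)
      simpa [div_self (hδ 0).ne'] using this
    rw [Real.norm_of_nonneg (Real.exp_pos _).le, Real.exp_le_exp]
    have hsq := pow_le_pow_left₀ (div_nonneg h0 zero_le_two) h1 2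
    rw [div_pow] at hsq
    linarith
  · refine ae_of_all _ fun y => ?_
    exact (Real.continuous_exp.tendsto _).comp ((tendsto_sum_ratio_mul_inner_sq
      (hpos.mono fun δ h => h 0) hnorm hv hlam y).const_mul _)

end Limit

/-! ### The asymptotic formula -/

theorem proposition4p1
    {Ω : Type*} [MeasurableSpace Ω] (P : Measure Ω) [IsProbabilityMeasure P]
    (n : ℕ) [NeZero n]
    (s : Fin n → ℝ) (hs : ∀ j, s j = 1 ∨ s j = -1)
    (T : ℝ → Ω → EuclideanSpace ℝ (Fin n))
    (lam : ℝ → Fin n → ℝ)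
    (v : ℝ → Fin n → EuclideanSpace ℝ (Fin n))
    (vbar : EuclideanSpace ℝ (Fin n))
    -- centered Gaussian vectors with positive definite covariance matrices
    (hGauss : ∀ δ, 0 < δ → HasGaussianLaw (T δ) P)
    (hmean : ∀ δ, 0 < δ → ∫ ω, T δ ω ∂P = 0)
    (hpos : ∀ δ, 0 < δ → (covarianceMatrix (T δ) P).PosDef)
    -- `v δ` is an orthonormal family of eigenvectors, `lam δ` the eigenvalues
    (hortho : ∀ δ, 0 < δ → Orthonormal ℝ (v δ))
    (heig : ∀ δ, 0 < δ → ∀ k,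
      (covarianceMatrix (T δ) P).mulVec (v δ k).ofLp = lam δ k • (v δ k).ofLp)
    -- convergence of the eigenvector with index `0` (the first one), and the sign condition
    (hv : Tendsto (fun δ => v δ 0) (𝓝[>] 0) (𝓝 vbar))
    (hsign : ∀ j, 0 < s j * vbar j)
    -- the first eigenvalue is asymptotically negligible with respect to all others
    (hlam : ∀ k, k ≠ 0 → Tendsto (fun δ => lam δ 0 / lam δ k) (𝓝[>] 0) (𝓝 0)) :
    Tendsto
      (fun δ => orthantProb s (T δ) P * √((covarianceMatrix (T δ) P).det / lam δ 0 ^ n))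
      (𝓝[>] 0)
      (𝓝 (Real.Gamma ((n : ℝ) / 2) /
          (2 * Real.pi ^ ((n : ℝ) / 2) * ((n - 1).factorial : ℝ)) * |∏ j, vbar j|⁻¹)) := by

  have hn : 0 < n := NeZero.pos n
  have := Fin.pos_iff_nonempty.1 hn
  have hbasis (δ : ℝ) (hδ : 0 < δ) :
      ∃ b : OrthonormalBasis (Fin n) ℝ (EuclideanSpace ℝ (Fin n)), ⇑b = v δ := by
    have hspan := (basisOfOrthonormalOfCardEqFinrank (hortho δ hδ) (by simp)).span_eq
    rw [coe_basisOfOrthonormalOfCardEqFinrank] at hspan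
    exact ⟨OrthonormalBasis.mk (hortho δ hδ) hspan.ge, OrthonormalBasis.coe_mk _ _⟩
  have hlpos (δ : ℝ) (hδ : 0 < δ) (k : Fin n) : 0 < lam δ k := by
    obtain ⟨b, hb⟩ := hbasis δ hδ
    exact eigenvalue_pos (b := b) (hpos δ hδ) (by simpa only [hb] using heig δ hδ) k
  have hmem : ∀ᶠ δ in 𝓝[>] (0 : ℝ), 0 < δ := self_mem_nhdsWithin
  have hlim := (tendsto_integral_signOrthant hs (hmem.mono hlpos)
    (hmem.mono fun δ hδ k => (hortho δ hδ).norm_eq_one k) hv hsign hlam).const_mul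
      (√(2 * Real.pi) ^ n)⁻¹
  rw [integral_signOrthant_exp_neg_mul_inner_sq hsign one_half_pos] at hlim
  -- The factor (1/2)^(-n/2) = 2^(n/2) cancels the power of 2 in (2π)^(n/2).
  have hconst : (√(2 * Real.pi) ^ n)⁻¹ * (|∏ j, vbar j|⁻¹ * ((1 / 2 : ℝ) ^ (-(n : ℝ) / 2) / 2 *
      Real.Gamma ((n : ℝ) / 2) / (n - 1).factorial)) =
      Real.Gamma ((n : ℝ) / 2) /
          (2 * Real.pi ^ ((n : ℝ) / 2) * ((n - 1).factorial : ℝ)) * |∏ j, vbar j|⁻¹ := by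
    have hpi := Real.pi_pos
    have h1 : √(2 * Real.pi) ^ n = 2 ^ ((n : ℝ) / 2) * Real.pi ^ ((n : ℝ) / 2) := by
      rw [← Real.mul_rpow zero_le_two hpi.le, Real.sqrt_eq_rpow, ← Real.rpow_natCast,
        ← Real.rpow_mul (by positivity)]
      ring_nf
    have h2 : (1 / 2 : ℝ) ^ (-(n : ℝ) / 2) = 2 ^ ((n : ℝ) / 2) := by
      rw [one_div, Real.inv_rpow zero_le_two, ← Real.rpow_neg zero_le_two]
      ring_nf
    rw [h1, h2]
    field_simp
  rw [hconst] at hlim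
  refine hlim.congr' ?_
  filter_upwards [hmem] with δ hδ
  obtain ⟨b, hb⟩ := hbasis δ hδ
  rw [orthantProb_mul_sqrt_det_div (b := b) (hGauss δ hδ) (hmean δ hδ)
    (by simpa only [hb] using heig δ hδ) (hlpos δ hδ) (hlpos δ hδ 0) s, hb]
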